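/- **Theorem 8.** Consider the CONGEST model: the vertices of an $n$-vertex graph $G$ carry the identifiers $0,\dots,n-1$; each vertex initially knows its own identifier and its incident edges (the identifiers of its neighbors and, in a directed graph, the edge orientations); local computation is unbounded; in each synchronous round a vertex may send a message of at most $\beta\lceil\log_2 n\rceil$ bits ($\beta$ a constant) along each incident edge, edges being bidirectional as communication links. For $x\neq y$ let $d(x,y)$ be the unweighted distance and let $d_2(x,y)$ (the second simple shortest path distance) be the minimum length of a simple $x$-$y$ path that differs in at least one edge from a fixed shortest $x$-$y$ path ($\infty$ if there is none; the value does not depend on the shortest path chosen). An algorithm computes an $\alpha$-approximation of all-pairs second simple shortest path distances (2-APSiSP) in $R$ rounds if after $R$ rounds every vertex $y$ outputs, for every $x\ne y$, a value $\hat d(x,y)$ with $d_2(x,y)\le\hat d(x,y)\le\alpha\, d_2(x,y)$. Algorithms may be randomized (even with shared randomness); on each input graph all outputs must simultaneously be correct with probability at least $2/3$. Moreover, APSP distances are known in advance: every vertex $t$ is initially given $d(s,t)$ for all vertices $s$. Even so, 2-APSiSP requires $\tilde\Omega(n)$ rounds, namely: 1. (Undirected unweighted graphs.) For every $\varepsilon>0$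 there is a constant $D$ such that for every $\beta$ there are $c>0$ and $N$ with the following property: for all $n\ge N$, every algorithm that computes a $(3-\varepsilon)$-approximation of 2-APSiSP in $R$ rounds on all undirected unweighted $n$-vertex graphs of diameter at most $D$ satisfies $R\ge c\,n/\log n$. In particular ($\varepsilon=2$) this holds for exact computation. 2. (Directed unweighted graphs.) There is a constant $D$ such that for every $\beta$ there are $c>0$ and $N$ with the following property: for all $n\ge N$ and every finite ratio $\alpha$ (which may depend on $n$), every algorithm that computes an $\alpha$-approximation of 2-APSiSP in $R$ rounds on all directed unweighted $n$-vertex graphs whose underlying undirected graph has diameter at most $D$ satisfies $R\ge c\,n/\log n$. -/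

import Mathlib

open scoped ENNReal NNReal

/-! ## Unweighted (second) simple shortest path distances -/

/-- `p` is (the vertex sequence of) a simple directed path from `s` to `t` in `G`. -/
def IsSimplePath {V : Type} (G : Digraph V) (s t : V) (p : List V) : Prop :=
  p.head? = some s ∧ p.getLast? = some t ∧ p.IsChain G.Adj ∧ p.Nodup

/-- The number of edges of a path given by its vertex sequence. -/
def pathLength {V : Type} (p : List V) : ℕ := p.length - 1

/-- The distance `d(s,t)`: the minimum length of a simple `s`-`t` path, `⊤` if there is none. -/
noncomputable def pathDist {V : Type} (G : Digraph V) (s t : V) : ℕ∞ :=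
  ⨅ (p : List V) (_ : IsSimplePath G s t p), (pathLength p : ℕ∞)

/-- `p` is a shortest path from `s` to `t`. -/
def IsShortestPath {V : Type} (G : Digraph V) (s t : V) (p : List V) : Prop :=
  IsSimplePath G s t p ∧ (pathLength p : ℕ∞) = pathDist G s t

/-- The second simple shortest path distance `d₂(s,t)`: the minimum length of a simple `s`-`t`
path `p` that differs from a shortest `s`-`t` path `P`, and `⊤` if there is none. (Two simple
`s`-`t` paths with different vertex sequences differ in at least one edge.) By
`secondDist_eq_of_isShortestPath` the value does not depend on the choice of `P`. -/
noncomputable def secondDist {V : Type} (G : Digraph V) (s t : V) : ℕ∞ :=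
  ⨅ (P : List V) (_ : IsShortestPath G s t P) (p : List V)
    (_ : IsSimplePath G s t p ∧ p ≠ P), (pathLength p : ℕ∞)

theorem secondDist_eq_of_isShortestPath {V : Type} (G : Digraph V) (s t : V) (P : List V)
    (hP : IsShortestPath G s t P) :
    secondDist G s t =
      ⨅ (p : List V) (_ : IsSimplePath G s t p ∧ p ≠ P), (pathLength p : ℕ∞) := by
  apply le_antisymm
  · exact iInf₂_le P hP
  · refine le_iInf₂ fun Q hQ => le_iInf₂ fun p hp => ?_
    by_cases h : p = P
    · subst h
      refine (iInf₂_le Q ⟨hQ.1, fun h' => hp.2 h'.symm⟩).trans ?_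
      rw [hQ.2, hP.2]
    · exact iInf₂_le p ⟨hp.1, h⟩

/-- An undirected graph, viewed as the digraph with both orientations of every edge. -/
def SimpleGraph.asDigraph {V : Type} (H : SimpleGraph V) : Digraph V := ⟨H.Adj⟩

/-! ## The CONGEST model -/

/-- Messages of at most `B` bits; the empty string also stands for "no message". -/
def Message (B : ℕ) : Type := {l : List Bool // l.length ≤ B}

/-- The empty message. -/
def Message.empty (B : ℕ) : Message B := ⟨[], Nat.zero_le B⟩

/-- What a vertex knows before the first round: its own identifier, the identifiers of its
neighbors (with the orientation of the incident edges), and its distances from all vertices. -/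
structure LocalInput (n : ℕ) where
  id : Fin n
  outNbrs : Set (Fin n)
  inNbrs : Set (Fin n)
  distFrom : Fin n → ℕ∞

/-- The local input of vertex `v` of `G`; APSP distances are known: `v` knows `d(s,v)` for
all `s`. -/
noncomputable def localInput {n : ℕ} (G : Digraph (Fin n)) (v : Fin n) : LocalInput n where
  id := v
  outNbrs := {u | G.Adj v u}
  inNbrs := {u | G.Adj u v}
  distFrom := fun s => pathDist G s v

/-- A randomized CONGEST algorithm for `n`-vertex networks, with messages of at most `B` bits.
Vertices are identified with their identifiers, local computation is unrestricted. A random seed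
is drawn once and is visible to all vertices; an algorithm with private randomness is the case in
which the seed is a family indexed by the vertices and each vertex only uses its own component,
and a deterministic algorithm is the case of a one-point seed space. -/
structure CongestAlgorithm (n B : ℕ) where
  Seed : Type
  seedMeasurableSpace : MeasurableSpace Seed
  law : MeasureTheory.Measure Seed
  isProbabilityMeasure_law : MeasureTheory.IsProbabilityMeasure law
  /-- the local states of a vertex -/
  State : Type
  /-- the initial state of a vertex, from the seed and its local input -/
  init : Seed → LocalInput n → State
  /-- `send σ u` is the message for neighbor `u` in state `σ` -/
  send : State → Fin n → Message B
  /-- `receive σ m` is the state after a round in which `m u` was received from `u` -/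
  receive : State → (Fin n → Message B) → State
  /-- `output σ x` is the value that the vertex reports for source `x` -/
  output : State → Fin n → ℝ≥0∞

open Classical in
/-- The state of every vertex after `r` synchronous rounds on `G` with seed `ω`. Communication
links are the edges of the underlying undirected graph. -/
noncomputable def CongestAlgorithm.run {n B : ℕ} (A : CongestAlgorithm n B)
    (G : Digraph (Fin n)) (ω : A.Seed) : ℕ → Fin n → A.State
  | 0 => fun v => A.init ω (localInput G v)
  | r + 1 => fun v =>
      A.receive (A.run G ω r v) (fun u =>
        if G.toSimpleGraphInclusive.Adj u v then A.send (A.run G ω r u) v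
        else Message.empty B)

/-- After `R` rounds on `G` with seed `ω`, every vertex `y` knows, for every other vertex `x`, an
`α`-approximation of `d₂(x,y)`. -/
def CongestAlgorithm.Correct {n B : ℕ} (A : CongestAlgorithm n B) (R : ℕ) (α : ℝ≥0∞)
    (G : Digraph (Fin n)) (ω : A.Seed) : Prop :=
  ∀ x y : Fin n, x ≠ y →
    (secondDist G x y : ℝ≥0∞) ≤ A.output (A.run G ω R y) x ∧
    A.output (A.run G ω R y) x ≤ α * (secondDist G x y : ℝ≥0∞)

/-- Within `R` rounds, `A` computes `α`-approximate all pairs second simple shortest path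
distances of `G`, except with probability at most `1/3`. -/
def CongestAlgorithm.Approximates2APSiSP {n B : ℕ} (A : CongestAlgorithm n B) (R : ℕ) (α : ℝ≥0∞)
    (G : Digraph (Fin n)) : Prop :=
  letI := A.seedMeasurableSpace
  A.law {ω | ¬ A.Correct R α G ω} ≤ 1 / 3

/-!
The proof is an information bottleneck argument. Take a star with center `a`, two of whose leaves are
`y` and `z`, and join `z` to the elements of a set `S` of the other leaves (`hubGraph a z S`). The
vertex `y` keeps `a` as its only neighbor, and its distances from all vertices are `0`, `1` and `2`
whatever `S` is (`pathDist_hubGraph`), so its local input says nothing about `S`. Yet the second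
distance from a leaf `x` to `y` reveals whether `x ∈ S`: if so, the path `x z a y` has length `3`, and
otherwise `x a y` is the only simple path and the second distance is infinite
(`secondDist_hubGraph_eq_top_iff`). A value that approximates the second distance within a finite
ratio is finite exactly if the second distance is.

Hence the outputs of `y`, when correct, determine `S`, one of `2 ^ (n - 3)` sets, while `y` learns
about `S` only through the `R` messages from `a`, which take at most `(3 ^ B) ^ R` values
(`CongestAlgorithm.run_eq_of_send_eq`, `Message.natCard_le`). Averaging over the seeds yields one seed
for which two thirds of all `S` are decoded correctly (`exists_card_filter_mem_le`), so
`R * B` is at least linear in `n`; with `B = β * ⌈log₂ n⌉` this is the claim. The graphs are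
undirected of diameter at most `2`, and they serve for the directed case as well, with both
orientations of each edge.
-/

/-! ### The hub graphs -/

/-- A star with center `a` on all of `V`, together with an edge from `z` to every element of `S`. -/
def hubGraph {V : Type} (a z : V) (S : Set V) : SimpleGraph V :=
  SimpleGraph.fromRel fun u v => u = a ∨ (u = z ∧ v ∈ S)

section HubGraph

variable {V : Type} {a z y : V} {S : Set V}

lemma hubGraph_adj {u v : V} : (hubGraph a z S).Adj u v ↔
    u ≠ v ∧ ((u = a ∨ (u = z ∧ v ∈ S)) ∨ (v = a ∨ (v = z ∧ u ∈ S))) := by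
  simp [hubGraph, SimpleGraph.fromRel_adj]

lemma hubGraph_adj_center {v : V} (hv : v ≠ a) : (hubGraph a z S).Adj v a := by
  simp [hubGraph_adj, hv]

lemma hubGraph_adj_leaf {x v : V} (hxa : x ≠ a) (hxz : x ≠ z) (hxS : x ∉ S) :
    (hubGraph a z S).Adj v x ↔ v = a := by
  rw [hubGraph_adj]
  constructor
  · rintro ⟨-, (h | h) | (h | h)⟩
    · exact h
    · exact absurd h.2 hxS
    · exact absurd h hxa
    · exact absurd h.1 hxz
  · rintro rfl
    exact ⟨hxa.symm, .inl (.inl rfl)⟩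

lemma ediam_hubGraph_le : (hubGraph a z S).ediam ≤ 2 := by
  have key (v : V) : (hubGraph a z S).edist v a ≤ 1 := by
    by_cases hv : v = a
    · simp [hv]
    · exact (SimpleGraph.edist_eq_one_iff_adj.mpr (hubGraph_adj_center hv)).le
  refine SimpleGraph.ediam_le_of_edist_le fun u v => ?_
  calc (hubGraph a z S).edist u v
      ≤ (hubGraph a z S).edist u a + (hubGraph a z S).edist a v :=
        SimpleGraph.edist_triangle
    _ ≤ 1 + 1 := add_le_add (key u) (SimpleGraph.edist_comm.trans_le (key v))
    _ = 2 := one_add_one_eq_two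

lemma toSimpleGraphInclusive_asDigraph (H : SimpleGraph V) :
    H.asDigraph.toSimpleGraphInclusive = H := by
  ext u v
  simp only [Digraph.toSimpleGraphInclusive, SimpleGraph.asDigraph, SimpleGraph.fromRel_adj]
  exact ⟨fun h => h.2.elim id .symm, fun h => ⟨h.ne, .inl h⟩⟩

open Classical in
/-- The distances to a leaf `y` of the star do not depend on `S`. -/
lemma pathDist_hubGraph (hya : y ≠ a) (hyz : y ≠ z) (hyS : y ∉ S) (s : V) :
    pathDist (hubGraph a z S).asDigraph s y = if s = y then 0 else if s = a then 1 else 2 := by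
  have hay : (hubGraph a z S).Adj a y := (hubGraph_adj_center hya).symm
  apply le_antisymm
  · split_ifs with h h'
    · exact (iInf₂_le [y] (by simp [IsSimplePath, h])).trans (by simp [pathLength])
    · subst h'
      exact (iInf₂_le [s, y] (by simp [IsSimplePath, SimpleGraph.asDigraph, hay, h])).trans
        (by simp [pathLength])
    · exact (iInf₂_le [s, a, y] (by
        simp [IsSimplePath, SimpleGraph.asDigraph, hay, h, h', hubGraph_adj_center h', hya.symm])).trans
        (by simp [pathLength])
  · refine le_iInf₂ fun p hp => ?_
    obtain ⟨h1, h2, h3, -⟩ := hp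
    match p, h1, h2, h3 with
    | [v], h1, h2, _ => simp_all
    | [v, w], h1, h2, h3 =>
      simp only [List.head?_cons, Option.some.injEq, List.getLast?_cons_cons,
        List.getLast?_singleton] at h1 h2
      subst h1 h2
      have : v = a := (hubGraph_adj_leaf hya hyz hyS).1
        (by simpa [SimpleGraph.asDigraph] using h3)
      simp [this, hya.symm, pathLength]
    | u :: v :: w :: t, _, _, _ =>
      have : (2 : ℕ∞) ≤ (pathLength (u :: v :: w :: t) : ℕ∞) := by
        simp only [pathLength, List.length_cons]
        exact_mod_cast (by omega : 2 ≤ t.length + 1 + 1 + 1 - 1)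
      refine le_trans ?_ this
      split_ifs <;> simp

/-- A path that ends in a vertex `y` whose only neighbor is `a`, but avoids `a`, is trivial. -/
lemma eq_singleton_of_isChain_of_notMem {G : Digraph V} (hy : ∀ v, G.Adj v y → v = a) :
    ∀ r : List V, r.IsChain G.Adj → a ∉ r → r.getLast? = some y → r = [y]
  | [], _, _, h => by simp at h
  | [w], _, _, h => by simpa using h
  | w :: w' :: t, hc, ha, h => by
    rw [List.isChain_cons_cons] at hc
    have ih := eq_singleton_of_isChain_of_notMem hy (w' :: t) hc.2
      (fun h' => ha (List.mem_cons_of_mem _ h')) (by simpa using h)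
    obtain ⟨rfl, -⟩ := List.cons.inj ih
    exact absurd (hy w hc.1) fun h' => ha (by simp [h'])

lemma isSimplePath_hubGraph_eq (hya : y ≠ a) (hyz : y ≠ z) (hyS : y ∉ S) {x : V} (hxa : x ≠ a)
    (hxz : x ≠ z) (hxS : x ∉ S) (hxy : x ≠ y) {p : List V}
    (hp : IsSimplePath (hubGraph a z S).asDigraph x y p) : p = [x, a, y] := by
  obtain ⟨h1, h2, h3, h4⟩ := hp
  match p, h1, h2, h3, h4 with
  | [v], h1, h2, _, _ => simp_all
  | u :: v :: t, h1, h2, h3, h4 =>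
    obtain rfl : u = x := by simpa using h1
    rw [List.isChain_cons_cons] at h3
    obtain rfl : v = a := (hubGraph_adj_leaf hxa hxz hxS).1 (SimpleGraph.Adj.symm h3.1)
    have ht : t ≠ [] := by rintro rfl; exact hya (by simpa using h2.symm)
    obtain ⟨w, t, rfl⟩ := List.exists_cons_of_ne_nil ht
    have := eq_singleton_of_isChain_of_notMem (G := (hubGraph v z S).asDigraph)
      (fun v => (hubGraph_adj_leaf hya hyz hyS).1) (w :: t)
      (List.isChain_cons_cons.1 h3.2).2 (List.nodup_cons.1 (List.nodup_cons.1 h4).2).1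
      (by simpa using h2)
    rw [this]

/-- For a leaf `x` other than `y`, the edge from `z` to `x` is what makes a second path to `y`
possible. -/
lemma secondDist_hubGraph_eq_top_iff (hza : z ≠ a) (hya : y ≠ a) (hyz : y ≠ z) (hyS : y ∉ S)
    {x : V} (hxa : x ≠ a) (hxz : x ≠ z) (hxy : x ≠ y) :
    secondDist (hubGraph a z S).asDigraph x y = ⊤ ↔ x ∉ S := by
  have hay : (hubGraph a z S).Adj a y := (hubGraph_adj_center hya).symm
  constructor
  · intro h hxS
    have hshort : IsShortestPath (hubGraph a z S).asDigraph x y [x, a, y] := by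
      refine ⟨by simp [IsSimplePath, SimpleGraph.asDigraph, hay, hxy, hxa,
        hubGraph_adj_center hxa, hya.symm], ?_⟩
      rw [pathDist_hubGraph hya hyz hyS]
      simp [hxy, hxa, pathLength]
    have hadj : (hubGraph a z S).Adj x z := hubGraph_adj.2 ⟨hxz, .inr (.inr ⟨rfl, hxS⟩)⟩
    have hle : secondDist (hubGraph a z S).asDigraph x y ≤ (pathLength [x, z, a, y] : ℕ∞) := by
      rw [secondDist_eq_of_isShortestPath _ _ _ _ hshort]
      exact iInf₂_le [x, z, a, y] ⟨by simp [IsSimplePath, SimpleGraph.asDigraph, hay, hxy, hxa,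
        hxz, hadj, hubGraph_adj_center hza, hza, hya.symm, hyz.symm], by simp⟩
    rw [h, top_le_iff] at hle
    exact ENat.natCast_ne_top _ hle
  · intro hxS
    refine iInf₂_eq_top.2 fun P hP => iInf₂_eq_top.2 fun p hp => absurd ?_ hp.2
    rw [isSimplePath_hubGraph_eq hya hyz hyS hxa hxz hxS hxy hp.1,
      isSimplePath_hubGraph_eq hya hyz hyS hxa hxz hxS hxy hP.1]

end HubGraph

/-! ### Messages and transcripts -/

/-- A message is encoded by its `B` potential entries, each of which takes one of three values
(absent, `false`, `true`). -/
lemma Message.getElem?_injective (B : ℕ) :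
    Function.Injective fun (m : Message B) (i : Fin B) => m.1[(i : ℕ)]? := by
  intro m m' h
  refine Subtype.ext (List.ext_getElem? fun i => ?_)
  by_cases hi : i < B
  · exact congrFun h ⟨i, hi⟩
  · rw [List.getElem?_eq_none (m.2.trans (not_lt.1 hi)),
      List.getElem?_eq_none (m'.2.trans (not_lt.1 hi))]

instance (B : ℕ) : Finite (Message B) := Finite.of_injective _ (Message.getElem?_injective B)

lemma Message.natCard_le (B : ℕ) : Nat.card (Message B) ≤ 3 ^ B := by
  have := Nat.card_le_card_of_injective _ (Message.getElem?_injective B)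
  simpa [Nat.card_eq_fintype_card] using this

/-- The final state of a vertex `y` with a single neighbor `a` is determined by its local input
and by what `a` sends to it. -/
lemma CongestAlgorithm.run_eq_of_send_eq {n B : ℕ} (A : CongestAlgorithm n B)
    {G G' : Digraph (Fin n)} {y a : Fin n} (hin : localInput G y = localInput G' y)
    (hG : ∀ u, G.toSimpleGraphInclusive.Adj u y ↔ u = a)
    (hG' : ∀ u, G'.toSimpleGraphInclusive.Adj u y ↔ u = a) (ω : A.Seed) (R : ℕ)
    (h : ∀ r < R, A.send (A.run G ω r a) y = A.send (A.run G' ω r a) y) :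
    A.run G ω R y = A.run G' ω R y := by
  induction R with
  | zero => simp only [CongestAlgorithm.run, hin]
  | succ R ih =>
    simp only [CongestAlgorithm.run, hG, hG', ih fun r hr => h r (by omega)]
    congr 1
    funext u
    split_ifs with hu
    · rw [hu, h R (by omega)]
    · rfl

/-- Correct outputs distinguish finite from infinite second distances. -/
lemma CongestAlgorithm.Correct.output_eq_top_iff {n B : ℕ} {A : CongestAlgorithm n B} {R : ℕ}
    {α : ℝ≥0∞} (hα : α ≠ ⊤) {G : Digraph (Fin n)} {ω : A.Seed} (h : A.Correct R α G ω)
    {x y : Fin n} (hxy : x ≠ y) :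
    A.output (A.run G ω R y) x = ⊤ ↔ secondDist G x y = ⊤ := by
  obtain ⟨h1, h2⟩ := h x y hxy
  constructor
  · intro ht
    by_contra hne
    rw [ht, top_le_iff] at h2
    exact ENNReal.mul_ne_top hα (by simpa using hne) h2
  · intro ht
    simpa [ht] using h1

/-! ### Fixing the random seed -/

open MeasureTheory Classical in
/-- If each of finitely many events, not necessarily measurable, has outer measure at most `1/3`,
then some sample point lies in at most a third of them. -/
lemma exists_card_filter_mem_le {Ω ι : Type} [MeasurableSpace Ω] (μ : Measure Ω)
    [IsProbabilityMeasure μ] (s : Finset ι) (E : ι → Set Ω) (hE : ∀ i ∈ s, μ (E i) ≤ 1 / 3) :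
    ∃ ω, 3 * (s.filter fun i => ω ∈ E i).card ≤ s.card := by
  obtain ⟨ω, hω⟩ := exists_le_lintegral (μ := μ)
    -- measurable hulls, as the sets `E i` need not be measurable
    (f := fun ω => ∑ i ∈ s, (toMeasurable μ (E i)).indicator 1 ω)
    (Finset.measurable_sum _ fun i _ =>
      (measurable_one.indicator (measurableSet_toMeasurable _ _))).aemeasurable
  refine ⟨ω, ?_⟩
  have h1 : ∫⁻ ω, ∑ i ∈ s, (toMeasurable μ (E i)).indicator 1 ω ∂μ ≤ s.card * (1 / 3) := by
    rw [lintegral_finsetSum _ fun i _ =>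
      (measurable_one.indicator (measurableSet_toMeasurable _ _))]
    calc _ = ∑ i ∈ s, μ (E i) := Finset.sum_congr rfl fun i _ => by
            rw [lintegral_indicator_one (measurableSet_toMeasurable _ _), measure_toMeasurable]
      _ ≤ ∑ _i ∈ s, (1 / 3 : ℝ≥0∞) := Finset.sum_le_sum hE
      _ = _ := by simp
  have h2 : ((s.filter fun i => ω ∈ E i).card : ℝ≥0∞) ≤
      ∑ i ∈ s, (toMeasurable μ (E i)).indicator 1 ω := by
    rw [Finset.card_filter, Nat.cast_sum]
    refine Finset.sum_le_sum fun i _ => ?_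
    split_ifs with h
    · simp [subset_toMeasurable μ _ h]
    · simp
  have h3 := h2.trans (hω.trans h1)
  have h4 : (3 : ℝ≥0∞) * (s.filter fun i => ω ∈ E i).card ≤ s.card := by
    calc (3 : ℝ≥0∞) * (s.filter fun i => ω ∈ E i).card ≤ 3 * (s.card * (1 / 3)) := by gcongr
      _ = s.card * (3 * 3⁻¹) := by rw [one_div]; ring
      _ = s.card := by rw [ENNReal.mul_inv_cancel (by norm_num) (by norm_num), mul_one]
  exact_mod_cast h4

/-! ### The lower bound -/

lemma localInput_hubGraph_eq {n : ℕ} {a z y : Fin n} {S S' : Set (Fin n)} (hya : y ≠ a)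
    (hyz : y ≠ z) (hyS : y ∉ S) (hyS' : y ∉ S') :
    localInput (hubGraph a z S).asDigraph y = localInput (hubGraph a z S').asDigraph y := by
  have h (u : Fin n) : (hubGraph a z S).Adj u y ↔ (hubGraph a z S').Adj u y := by
    rw [hubGraph_adj_leaf hya hyz hyS, hubGraph_adj_leaf hya hyz hyS']
  simp only [localInput, SimpleGraph.asDigraph, LocalInput.mk.injEq, true_and]
  refine ⟨?_, ?_, ?_⟩
  · ext u
    simpa only [Set.mem_ofPred_eq, SimpleGraph.adj_comm _ y] using h u
  · ext u
    exact h u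
  · funext s
    exact (pathDist_hubGraph hya hyz hyS s).trans (pathDist_hubGraph hya hyz hyS' s).symm

/-- Transcript counting: the `R` messages that a leaf of the star receives must distinguish
two thirds of the `2 ^ (n - 3)` hub graphs. -/
lemma CongestAlgorithm.two_pow_le {n B : ℕ} (hn : 3 ≤ n) (A : CongestAlgorithm n B) (R : ℕ)
    {α : ℝ≥0∞} (hα : α ≠ ⊤)
    (hA : ∀ H : SimpleGraph (Fin n), H.ediam ≤ 2 → A.Approximates2APSiSP R α H.asDigraph) :
    2 * 2 ^ (n - 3) ≤ 3 * (3 ^ B) ^ R := by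
  classical
  let := A.seedMeasurableSpace
  have := A.isProbabilityMeasure_law
  let y : Fin n := ⟨0, by omega⟩
  let a : Fin n := ⟨1, by omega⟩
  let z : Fin n := ⟨2, by omega⟩
  have hya : y ≠ a := by simp [y, a]
  have hyz : y ≠ z := by simp [y, z]
  have hza : z ≠ a := by simp [a, z]
  let T : Finset (Fin n) := Finset.univ \ {y, a, z}
  have hT {x : Fin n} : x ∈ T ↔ x ≠ y ∧ x ≠ a ∧ x ≠ z := by simp [T]
  have hTcard : T.card = n - 3 := by
    rw [Finset.card_sdiff_of_subset (Finset.subset_univ _), Finset.card_univ, Fintype.card_fin,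
      Finset.card_eq_three.2 ⟨y, a, z, hya, hyz, hza.symm, rfl⟩]
  let G (S : Finset (Fin n)) : Digraph (Fin n) := (hubGraph a z (S : Set (Fin n))).asDigraph
  -- A seed for which the outputs are correct on at least two thirds of the graphs.
  obtain ⟨ω, hω⟩ := exists_card_filter_mem_le A.law T.powerset
    (fun S => {ω | ¬ A.Correct R α (G S) ω}) fun S _ => hA _ ediam_hubGraph_le
  have hsplit := Finset.card_filter_add_card_filter_not (s := T.powerset)
    (fun S => A.Correct R α (G S) ω)
  have hinj : Set.InjOn
      (fun (S : Finset (Fin n)) (r : Fin R) => A.send (A.run (G S) ω r a) y)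
      (T.powerset.filter fun S => A.Correct R α (G S) ω) := by
    intro S hS S' hS' h
    simp only [Finset.coe_filter, Finset.mem_powerset, Set.mem_ofPred_eq] at hS hS'
    have hyS : y ∉ (S : Set (Fin n)) := fun h => (hT.1 (hS.1 h)).1 rfl
    have hyS' : y ∉ (S' : Set (Fin n)) := fun h => (hT.1 (hS'.1 h)).1 rfl
    have hrun : A.run (G S) ω R y = A.run (G S') ω R y :=
      A.run_eq_of_send_eq (localInput_hubGraph_eq hya hyz hyS hyS')
        (fun u => by
          rw [toSimpleGraphInclusive_asDigraph]; exact hubGraph_adj_leaf hya hyz hyS)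
        (fun u => by
          rw [toSimpleGraphInclusive_asDigraph]; exact hubGraph_adj_leaf hya hyz hyS')
        ω R fun r hr => congrFun h ⟨r, hr⟩
    ext x
    by_cases hx : x ∈ T
    · obtain ⟨hxy, hxa, hxz⟩ := hT.1 hx
      have e := hS.2.output_eq_top_iff hα hxy
      rw [hrun, hS'.2.output_eq_top_iff hα hxy,
        secondDist_hubGraph_eq_top_iff hza hya hyz hyS hxa hxz hxy,
        secondDist_hubGraph_eq_top_iff hza hya hyz hyS' hxa hxz hxy] at e
      exact (not_iff_not.1 e).symm
    · exact ⟨fun h => absurd (hS.1 h) hx, fun h => absurd (hS'.1 h) hx⟩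
  have hcard : (T.powerset.filter fun S => A.Correct R α (G S) ω).card ≤ (3 ^ B) ^ R := by
    have := Set.ncard_le_ncard_of_injOn _ (t := Set.univ) (fun _ _ => Set.mem_univ _) hinj
    rw [Set.ncard_coe_finset, Set.ncard_univ, Nat.card_fun, Nat.card_fin] at this
    exact this.trans (Nat.pow_le_pow_left (Message.natCard_le B) R)
  -- At most a third of the `2 ^ (n - 3)` sets are decoded wrongly.
  simp only [Set.mem_ofPred_eq] at hω
  rw [Finset.card_powerset, hTcard] at hsplit hω
  omega

lemma natCast_clog_two_le {n : ℕ} (hn : 2 ≤ n) : (Nat.clog 2 n : ℝ) ≤ 4 * Real.log n := by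
  have h1 : Nat.clog 2 n ≤ Nat.log 2 n + 1 :=
    Nat.clog_le_of_le_pow (Nat.lt_pow_succ_log_self one_lt_two n).le
  have h2 : 1 ≤ Nat.log 2 n := Nat.log_pos one_lt_two hn
  have h3 : (Nat.log 2 n : ℝ) * Real.log 2 ≤ Real.log n := by
    rw [← Real.log_pow]
    exact Real.log_le_log (by positivity) (by exact_mod_cast Nat.pow_log_le_self 2 (by omega))
  have h4 : (Nat.clog 2 n : ℝ) ≤ 2 * Nat.log 2 n := by exact_mod_cast (by omega)
  have := Real.log_two_gt_d9
  have h5 : (0 : ℝ) ≤ Nat.log 2 n := Nat.cast_nonneg _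
  nlinarith

/-- The round bound for every finite ratio, already on undirected graphs of diameter `2`. -/
lemma CongestAlgorithm.div_log_le_rounds {n β : ℕ} (hn : 8 ≤ n)
    (A : CongestAlgorithm n (β * Nat.clog 2 n)) (R : ℕ) {α : ℝ≥0∞} (hα : α ≠ ⊤)
    (hA : ∀ H : SimpleGraph (Fin n), H.ediam ≤ 2 → A.Approximates2APSiSP R α H.asDigraph) :
    1 / (16 * (β + 1) : ℝ) * (n / Real.log n) ≤ R := by
  have h1 := A.two_pow_le (by omega) R hα hA
  have h2 : 2 ^ (n - 2) ≤ 2 ^ (2 * (β * Nat.clog 2 n * R) + 2) := by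
    calc 2 ^ (n - 2) = 2 * 2 ^ (n - 3) := by rw [← pow_succ']; congr 1; omega
      _ ≤ 3 * (3 ^ (β * Nat.clog 2 n)) ^ R := h1
      _ ≤ 4 * (4 ^ (β * Nat.clog 2 n)) ^ R := by gcongr <;> norm_num
      _ = _ := by rw [← pow_mul, pow_add, pow_mul 2 2, mul_comm]; norm_num
  have h3 := (Nat.pow_le_pow_iff_right one_lt_two).1 h2
  have h4 : (n : ℝ) ≤ 4 * (β * Nat.clog 2 n * R) := by exact_mod_cast (by omega)
  have hlog : 0 < Real.log n := Real.log_pos (by exact_mod_cast (by omega))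
  rw [div_mul_div_comm, one_mul, div_le_iff₀ (by positivity)]
  calc (n : ℝ) ≤ 4 * (β * Nat.clog 2 n * R) := h4
    _ ≤ 4 * ((β + 1) * (4 * Real.log n) * R) := by
      gcongr
      · simp
      · exact natCast_clog_two_le (by omega)
    _ = _ := by ring

theorem theorem8 :
    -- undirected graphs, ratio `3 - ε` (exact computation is `ε = 2`)
    (∀ ε : ℝ, 0 < ε → ∃ D : ℕ, ∀ β : ℕ, ∃ c : ℝ, 0 < c ∧ ∃ N : ℕ, ∀ n : ℕ, N ≤ n →
      ∀ (A : CongestAlgorithm n (β * Nat.clog 2 n)) (R : ℕ),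
        (∀ H : SimpleGraph (Fin n), H.ediam ≤ (D : ℕ∞) →
          A.Approximates2APSiSP R (ENNReal.ofReal (3 - ε)) H.asDigraph) →
        c * (n / Real.log n) ≤ R) ∧
    -- directed graphs, arbitrary finite ratio `α`
    (∃ D : ℕ, ∀ β : ℕ, ∃ c : ℝ, 0 < c ∧ ∃ N : ℕ, ∀ n : ℕ, N ≤ n → ∀ α : ℝ≥0,
      ∀ (A : CongestAlgorithm n (β * Nat.clog 2 n)) (R : ℕ),
        (∀ G : Digraph (Fin n), (∀ v, ¬ G.Adj v v) →
          G.toSimpleGraphInclusive.ediam ≤ (D : ℕ∞) →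
          A.Approximates2APSiSP R (α : ℝ≥0∞) G) →
        c * (n / Real.log n) ≤ R) := by
  -- Both parts hold with diameter `2`. An undirected graph is also a directed one, so the
  -- undirected bound gives the directed bound.
  constructor
  · intro ε _
    exact ⟨2, fun β => ⟨1 / (16 * (β + 1)), by positivity, 8, fun n hn A R hA =>
      A.div_log_le_rounds hn R ENNReal.ofReal_ne_top hA⟩⟩
  · exact ⟨2, fun β => ⟨1 / (16 * (β + 1)), by positivity, 8, fun n hn α A R hA =>
      A.div_log_le_rounds hn R ENNReal.coe_ne_top fun H hH =>
        hA _ (fun v => H.irrefl) (by rwa [toSimpleGraphInclusive_asDigraph])⟩⟩
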